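/- Theorem 4. Let $K\ge 1$, $\alpha>2$, $\lambda_b>0$, $c>0$ (in the network model $c=5/4$). Suppose that the distances of the $2K$ users of a cell to their base station are independent, each with density $2c\lambda_b\pi x e^{-c\lambda_b\pi x^2}$, $x\ge 0$. Rank the users in increasing order of distance, let $1\le r_k<r_{\tilde k}\le 2K$ be the ranks of the near and the far user of a pair, and let $d_k$ be the distance of the near user, i.e. the $r_k$-th smallest of the $2K$ distances. Let ${\bf u}_k\in\mathbb C^N\setminus\{0\}$ be the receive filter of the near user. For noise variance $\sigma^2\ge 0$, transmit power $P>0$ and interference power $\rho_I\ge 0$ put $\ell(x)=x^{-\alpha}$, $\sigma_k^2=\sigma^2\|{\bf u}_k\|^2$, $\omega_k=\Gamma(1-\frac2\alpha)\big(\frac{\rho_I}{P}|{\bf u}_k^{\rm H}{\bf 1}_N|^2\big)^{2/\alpha}$, and, for complex $s,t$ with positive real parts (all complex powers being principal), $$\varphi_k(s+t)=\mathbb E\Big\{e^{-\frac{\sigma_k^2}{P\ell(d_k)}(s+t)-\pi\lambda_b\omega_k d_k^2(s+t)^{2/\alpha}}\Big\},\qquad D_l=(2K-r_k+l+1)c+\omega_k(s+t)^{2/\alpha}.$$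 The expectation exists. If $\sigma^2>0$, then $$\varphi_k(s+t)=c\,r_k\binom{2K}{r_k}\sum_{l=0}^{r_k-1}\frac{(-1)^l\binom{r_k-1}{l}}{D_l}\,H_{1,1}^{1,1}\left(\frac{\sigma_k^2}{P}(s+t)\,(\pi\lambda_b D_l)^{-\frac\alpha2}\,\middle|\,\begin{array}{c}(0,\frac\alpha2)\\(0,1)\end{array}\right),$$ where $H^{1,1}_{1,1}$ is Fox's H-function, here $$H_{1,1}^{1,1}\left(z\,\middle|\,\begin{array}{c}(0,\frac\alpha2)\\(0,1)\end{array}\right)=\frac1{2\pi{\rm i}}\int_{\gamma-{\rm i}\infty}^{\gamma+{\rm i}\infty}\Gamma(v)\,\Gamma\big(1-\tfrac\alpha2 v\big)\,z^{-v}\,dv,\qquad 0<\gamma<\tfrac2\alpha,$$ and these integrals converge absolutely and do not depend on $\gamma$. In the interference-limited regime $\sigma^2/P\to0$ (with $K,r_k,c,\alpha,\lambda_b,{\bf u}_k,s,t$ fixed), $$\varphi_k(s+t)-c\,r_k\binom{2K}{r_k}\sum_{l=0}^{r_k-1}\frac{(-1)^l\binom{r_k-1}{l}}{(2K-r_k+l+1)c+\omega_k(s+t)^{2/\alpha}}\longrightarrow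 0,$$ uniformly in $P>0$ and $\rho_I\ge 0$; in particular, if $\rho_I/P$, and hence $\omega_k$, is kept fixed, then $\varphi_k(s+t)$ tends to this sum expression. -/

import Mathlib

open MeasureTheory ProbabilityTheory
open scoped BigOperators

noncomputable section

/-! ### Fox's H-function through its Mellin-Barnes integral along a vertical line -/

/-- The Mellin-Barnes kernel of `H^{m,n}_{p,q}` with upper parameters `(a j, A j)` and lower
parameters `(b j, B j)`. A reciprocal `(Gamma x)⁻¹` vanishes at the poles of `Gamma`, also in Lean. -/
def foxKernel (m n : ℕ) {p q : ℕ} (a : Fin p → ℂ) (A : Fin p → ℝ) (b : Fin q → ℂ) (B : Fin q → ℝ)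
    (u : ℂ) : ℂ :=
  (∏ j : Fin q, if (j : ℕ) < m then Complex.Gamma (b j + B j * u)
      else (Complex.Gamma (1 - b j - B j * u))⁻¹) *
  (∏ j : Fin p, if (j : ℕ) < n then Complex.Gamma (1 - a j - A j * u)
      else (Complex.Gamma (a j + A j * u))⁻¹)

/-- The vertical line `Re u = γ` separates the poles of `Gamma (b j + B j u)`, `j < m` (on its left),
from the poles of `Gamma (1 - a j - A j u)`, `j < n` (on its right). -/
def FoxSeparates (m n : ℕ) {p q : ℕ} (a : Fin p → ℂ) (A : Fin p → ℝ) (b : Fin q → ℂ)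
    (B : Fin q → ℝ) (γ : ℝ) : Prop :=
  (∀ j : Fin q, (j : ℕ) < m → ∀ i : ℕ, (-(b j + i) / (B j : ℂ)).re < γ) ∧
  (∀ j : Fin p, (j : ℕ) < n → ∀ i : ℕ, γ < ((1 - a j + i) / (A j : ℂ)).re)

/-- The Mellin-Barnes integrand `Θ(u) z^{-u}` at `u = γ + i y`. -/
def foxIntegrand (m n : ℕ) {p q : ℕ} (a : Fin p → ℂ) (A : Fin p → ℝ) (b : Fin q → ℂ)
    (B : Fin q → ℝ) (z : ℂ) (γ y : ℝ) : ℂ :=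
  foxKernel m n a A b B (γ + y * Complex.I) * z ^ (-(γ + y * Complex.I : ℂ))

/-- `(2 π i)⁻¹ ∫ Θ(u) z^{-u} du` over the line `Re u = γ`, oriented upwards. -/
def foxLineIntegral (m n : ℕ) {p q : ℕ} (a : Fin p → ℂ) (A : Fin p → ℝ) (b : Fin q → ℂ)
    (B : Fin q → ℝ) (z : ℂ) (γ : ℝ) : ℂ :=
  (1 / (2 * Real.pi : ℂ)) * ∫ y : ℝ, foxIntegrand m n a A b B z γ y

open Classical in
/-- Fox's H-function `H^{m,n}_{p,q}(z | (a, A); (b, B))` for parameters whose two families of poles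
are separated by a vertical line: the Mellin-Barnes integral along such a line. -/
def foxH (m n : ℕ) {p q : ℕ} (a : Fin p → ℂ) (A : Fin p → ℝ) (b : Fin q → ℂ) (B : Fin q → ℝ)
    (z : ℂ) : ℂ :=
  if h : ∃ γ : ℝ, FoxSeparates m n a A b B γ then foxLineIntegral m n a A b B z h.choose else 0

/-- The value `foxH` is meaningful at `z`: a separating vertical line exists, and along each such line
the Mellin-Barnes integral converges absolutely to that same value. -/
def FoxHWellDefined (m n : ℕ) {p q : ℕ} (a : Fin p → ℂ) (A : Fin p → ℝ) (b : Fin q → ℂ)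
    (B : Fin q → ℝ) (z : ℂ) : Prop :=
  (∃ γ : ℝ, FoxSeparates m n a A b B γ) ∧
  ∀ γ : ℝ, FoxSeparates m n a A b B γ →
    Integrable (foxIntegrand m n a A b B z γ) ∧
    foxLineIntegral m n a A b B z γ = foxH m n a A b B z

/-! ### Distances of the users and their order statistics -/

/-- The density `2 c λ π x exp (-c λ π x²)`, `x ≥ 0`, of the distance of a user to its base station. -/
def distPDF (c lam x : ℝ) : ℝ :=
  if 0 ≤ x then 2 * c * lam * Real.pi * x * Real.exp (-(c * lam * Real.pi * x ^ 2)) else 0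

/-- The law on `ℝ` with density `distPDF c lam`. -/
def distLaw (c lam : ℝ) : Measure ℝ :=
  volume.withDensity fun x => ENNReal.ofReal (distPDF c lam x)

/-- The `r`-th smallest entry of `v`, for `1 ≤ r ≤ n`. -/
def orderStat {n : ℕ} (v : Fin n → ℝ) (r : ℕ) : ℝ :=
  if h : 1 ≤ r ∧ r ≤ n then v (Tuple.sort v ⟨r - 1, by omega⟩) else 0

/-! ### The quantities of the network -/

/-- Path loss `ℓ(x) = x^{-α}`. -/
def pathLoss (α x : ℝ) : ℝ := x ^ (-α)

/-- Noise power `σ² ‖u‖²` after the receive filter `u`. -/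
def filteredNoise {N : ℕ} (sigmaSq : ℝ) (u : EuclideanSpace ℂ (Fin N)) : ℝ := sigmaSq * ‖u‖ ^ 2

/-- `Γ(1 - 2/α) ((ρ_I / P) |uᴴ 1|²)^{2/α}`. -/
def omegaCoeff {N : ℕ} (α P rho : ℝ) (u : EuclideanSpace ℂ (Fin N)) : ℝ :=
  Real.Gamma (1 - 2 / α) * (rho / P * ‖∑ j, star (u j)‖ ^ 2) ^ (2 / α)

/-- `exp (-(σ² ‖u‖² / (P ℓ(x))) w - π λ ω x² w^{2/α})` for a user at distance `x`. -/
def phiIntegrand {N : ℕ} (α lam sigmaSq P rho : ℝ) (u : EuclideanSpace ℂ (Fin N)) (w : ℂ)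
    (x : ℝ) : ℂ :=
  Complex.exp
    (-((filteredNoise sigmaSq u / (P * pathLoss α x) : ℝ) : ℂ) * w
      - ((Real.pi * lam * omegaCoeff α P rho u * x ^ 2 : ℝ) : ℂ) * w ^ ((2 / α : ℝ) : ℂ))

/-- `φ(w)`: the expectation of `phiIntegrand` at the (random) distance `dist` of the user. -/
def phi {Ω : Type*} [MeasurableSpace Ω] (μ : Measure Ω) (dist : Ω → ℝ) {N : ℕ}
    (α lam sigmaSq P rho : ℝ) (u : EuclideanSpace ℂ (Fin N)) (w : ℂ) : ℂ :=
  ∫ x, phiIntegrand α lam sigmaSq P rho u w (dist x) ∂μ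

/-- `(2K - r + l + 1) c + ω w^{2/α}`. -/
def rankDenom {N : ℕ} (K r l : ℕ) (c α P rho : ℝ) (u : EuclideanSpace ℂ (Fin N)) (w : ℂ) : ℂ :=
  (2 * (K : ℂ) - r + l + 1) * c + omegaCoeff α P rho u * w ^ ((2 / α : ℝ) : ℂ)

/-- `(σ² ‖u‖² / P) w (π λ ((2K - r + l + 1) c + ω w^{2/α}))^{-α/2}`. -/
def foxArg {N : ℕ} (K r l : ℕ) (c α lam sigmaSq P rho : ℝ) (u : EuclideanSpace ℂ (Fin N))
    (w : ℂ) : ℂ :=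
  ((filteredNoise sigmaSq u / P : ℝ) : ℂ) * w *
    ((Real.pi * lam : ℝ) * rankDenom K r l c α P rho u w) ^ ((-(α / 2) : ℝ) : ℂ)

end

/-! The r-th order statistic of n independent distances has a binomial tail of the common
distribution function as its distribution function. Its derivative telescopes to a single term,
which is the density. Expanding the power of `1 - exp (-a x²)` in that density and substituting `y =
x²` turns φ into a finite combination of the integrals `∫₀^∞ exp (-E y - B y^β) dy` with `β = α/2`,
`E = π λ D_l`, `B = (σ_k²/P) w` (`phi_eq_sum_rankLaplace`).

Each such integral is a Fox function divided by E (`foxH_eq_laplace`): write `exp (-B x^β)` as the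
inverse Mellin transform of `B^{-v} Γ(v)`, exchange the integrals, and evaluate the x-integral as
`Γ(1 - β v) E^{β v - 1}`. Two analytic facts carry this: the Gamma integral for complex rates, and
the resulting decay of Γ on vertical lines, which beats the growth of `B^{-v}`. Merging `B^{-v} E^{β
v}` into one principal power needs `|arg B| + β |arg E| < π`. This holds since adding a positive
real to `ω w^{2/α}` cannot increase `|arg|`, so `β |arg E| ≤ |arg w| < π/2`.

For the limit, `|exp (-B x^β) - 1| ≤ |B| x^β` compares each integral with `1/E`. The error is at
most a constant times `σ²/P`, uniformly because `Re D_l ≥ c` whatever ω is. -/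

/-! ### Gamma integrals with complex rate and Mellin inversion of the exponential. -/

theorem norm_ofReal_cpow_sub_one_mul_exp_neg {x : ℝ} (hx : 0 < x) (a r : ℂ) :
    ‖(x : ℂ) ^ (a - 1) * Complex.exp (-(r * x))‖ =
      x ^ (a.re - 1) * Real.exp (-(r.re * x)) := by
  rw [norm_mul, Complex.norm_cpow_eq_rpow_re_of_pos hx, Complex.norm_exp]
  simp

theorem integrableOn_rpow_mul_exp_neg_mul {s b : ℝ} (hs : -1 < s) (hb : 0 < b) :
    IntegrableOn (fun x : ℝ => x ^ s * Real.exp (-(b * x))) (Set.Ioi 0) := by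
  simpa using integrableOn_rpow_mul_exp_neg_mul_rpow hs zero_lt_one hb

theorem integrableOn_cpow_mul_exp_neg_mul {a r : ℂ} (ha : 0 < a.re) (hr : 0 < r.re) :
    IntegrableOn (fun x : ℝ => (x : ℂ) ^ (a - 1) * Complex.exp (-(r * x))) (Set.Ioi 0) := by
  refine (integrableOn_rpow_mul_exp_neg_mul (s := a.re - 1) (by linarith) hr).mono'
    (by fun_prop : Measurable _).aestronglyMeasurable ?_
  filter_upwards [ae_restrict_mem measurableSet_Ioi] with x hx
  exact (norm_ofReal_cpow_sub_one_mul_exp_neg hx a r).le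

theorem differentiableOn_integral_cpow_mul_exp_neg_mul {a : ℂ} (ha : 0 < a.re) :
    DifferentiableOn ℂ (fun r : ℂ => ∫ x : ℝ in Set.Ioi 0,
      (x : ℂ) ^ (a - 1) * Complex.exp (-(r * x))) {r | 0 < r.re} := by
  intro r hr
  have hr' : 0 < r.re := hr
  refine (hasDerivAt_integral_of_dominated_loc_of_deriv_le (s := {z : ℂ | r.re / 2 < z.re})
    (x₀ := r) (μ := volume.restrict (Set.Ioi 0))
    (F := fun z (x : ℝ) => (x : ℂ) ^ (a - 1) * Complex.exp (-(z * x)))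
    (F' := fun z (x : ℝ) => (x : ℂ) ^ (a - 1) * (Complex.exp (-(z * x)) * (-x)))
    (bound := fun x : ℝ => x ^ a.re * Real.exp (-(r.re / 2 * x)))
    ?_ (.of_forall fun z => (by fun_prop : Measurable _).aestronglyMeasurable)
    (integrableOn_cpow_mul_exp_neg_mul ha hr)
    (by fun_prop : Measurable _).aestronglyMeasurable ?_
    (integrableOn_rpow_mul_exp_neg_mul (by linarith) (by linarith))
    ?_).2.differentiableAt.differentiableWithinAt
  · exact (isOpen_lt continuous_const Complex.continuous_re).mem_nhds
      (show r.re / 2 < r.re by linarith)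
  · filter_upwards [ae_restrict_mem measurableSet_Ioi] with x (hx : 0 < x) z (hz : _ < _)
    rw [← mul_assoc, norm_mul, norm_ofReal_cpow_sub_one_mul_exp_neg hx, norm_neg,
      Complex.norm_real, Real.norm_of_nonneg hx.le, mul_right_comm, ← Real.rpow_add_one hx.ne',
      sub_add_cancel]
    gcongr
  · refine .of_forall fun x z _ => ?_
    have : HasDerivAt (fun z : ℂ => -(z * x)) (-(x : ℂ)) z := by
      simpa using! ((hasDerivAt_id z).mul_const (x : ℂ)).neg
    exact this.cexp.const_mul _

/-- The Gamma integral with a complex rate in the right half plane. -/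
theorem integral_cpow_mul_exp_neg_mul_Ioi_of_re_pos {a r : ℂ} (ha : 0 < a.re) (hr : 0 < r.re) :
    ∫ x : ℝ in Set.Ioi 0, (x : ℂ) ^ (a - 1) * Complex.exp (-(r * x)) =
      r ^ (-a) * Complex.Gamma a := by
  have hopen : IsOpen {r : ℂ | 0 < r.re} := isOpen_lt continuous_const Complex.continuous_re
  have h1 := (differentiableOn_integral_cpow_mul_exp_neg_mul ha).analyticOnNhd hopen
  have h2 : AnalyticOnNhd ℂ (fun r : ℂ => r ^ (-a) * Complex.Gamma a) {r | 0 < r.re} := by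
    refine DifferentiableOn.analyticOnNhd (fun z hz => ?_) hopen
    exact ((differentiableAt_id.cpow_const (Or.inl hz)).mul_const _).differentiableWithinAt
  -- Identity theorem: both sides are analytic in the rate, and they agree at the real rates `1 +
  -- 1/(n+1)`, which accumulate at 1.
  refine h1.eqOn_of_preconnected_of_frequently_eq (z₀ := 1) h2
    (convex_halfSpace_re_gt 0).isPreconnected (by simp) ?_ hr
  have hlim : Filter.Tendsto (fun n : ℕ => ((1 + 1 / ((n : ℝ) + 1) : ℝ) : ℂ)) Filter.atTop
      (nhdsWithin 1 {1}ᶜ) := by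
    refine tendsto_nhdsWithin_iff.2 ⟨?_, .of_forall fun n => ?_⟩
    · have := (tendsto_one_div_add_atTop_nhds_zero_nat (𝕜 := ℝ)).const_add 1
      simpa [Function.comp_def] using (Complex.continuous_ofReal.tendsto _).comp this
    · have : 0 < 1 / ((n : ℝ) + 1) := by positivity
      rw [Set.mem_compl_iff, Set.mem_singleton_iff, Complex.ofReal_eq_one]
      linarith
  refine hlim.frequently (Filter.Frequently.of_forall fun n => ?_)
  have hpos : (0 : ℝ) < 1 + 1 / ((n : ℝ) + 1) := by positivity
  rw [Complex.integral_cpow_mul_exp_neg_mul_Ioi ha hpos, one_div,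
    Complex.inv_cpow _ _ (by rw [Complex.arg_ofReal_of_nonneg hpos.le]; exact Real.pi_pos.ne),
    Complex.cpow_neg]

/-- Exponential decay of `Gamma` on vertical lines. -/
theorem exists_norm_Gamma_le_exp {γ θ : ℝ} (hγ : 0 < γ) (hθ : 0 ≤ θ) (hθ' : θ < Real.pi / 2) :
    ∃ C : ℝ, ∀ y : ℝ, ‖Complex.Gamma (γ + y * Complex.I)‖ ≤ C * Real.exp (-(θ * |y|)) := by
  refine ⟨∫ x : ℝ in Set.Ioi 0, x ^ (γ - 1) * Real.exp (-(Real.cos θ * x)), fun y => ?_⟩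
  -- Apply the Gamma integral with rate `e^{iη}`, η having the sign of y: then `|r^{-a}| =
  -- e^{θ|y|}`, while the integral is bounded independently of y because `cos θ > 0`.
  obtain ⟨η, hη, hηy⟩ : ∃ η : ℝ, |η| = θ ∧ η * y = θ * |y| := by
    rcases le_total 0 y with h | h
    · exact ⟨θ, abs_of_nonneg hθ, by rw [abs_of_nonneg h]⟩
    · exact ⟨-θ, by rw [abs_neg, abs_of_nonneg hθ], by rw [abs_of_nonpos h]; ring⟩
  have hη' := abs_lt.1 (hη.trans_lt hθ')
  have hcos : Real.cos η = Real.cos θ := by rw [← hη, Real.cos_abs]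
  have hre : (Complex.exp (η * Complex.I)).re = Real.cos θ := by
    rw [Complex.exp_ofReal_mul_I_re, hcos]
  have harg : (Complex.exp (η * Complex.I)).arg = η := by
    rw [Complex.arg_exp_mul_I, toIocMod_eq_self]
    constructor <;> linarith [Real.pi_pos]
  have ha : (0 : ℝ) < (γ + y * Complex.I : ℂ).re := by simpa using hγ
  have key := integral_cpow_mul_exp_neg_mul_Ioi_of_re_pos (r := Complex.exp (η * Complex.I)) ha
    (by rw [hre, ← hcos]; exact Real.cos_pos_of_mem_Ioo hη')
  have hnorm : ‖Complex.exp (η * Complex.I) ^ (-(γ + y * Complex.I : ℂ))‖ =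
      Real.exp (θ * |y|) := by
    rw [Complex.norm_cpow_of_ne_zero (Complex.exp_ne_zero _), harg, Complex.norm_exp_ofReal_mul_I]
    simp [← Real.exp_neg, hηy]
  have hle : ‖Complex.exp (η * Complex.I) ^ (-(γ + y * Complex.I : ℂ)) *
      Complex.Gamma (γ + y * Complex.I)‖ ≤
      ∫ x : ℝ in Set.Ioi 0, x ^ (γ - 1) * Real.exp (-(Real.cos θ * x)) := by
    rw [← key]
    refine (norm_integral_le_integral_norm _).trans_eq
      (setIntegral_congr_fun measurableSet_Ioi fun x hx => ?_)
    simp only [norm_ofReal_cpow_sub_one_mul_exp_neg hx, hre]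
    simp
  rw [norm_mul, hnorm] at hle
  rw [Real.exp_neg, ← div_eq_mul_inv, le_div_iff₀ (Real.exp_pos _), mul_comm]
  exact hle

theorem continuous_Gamma_vertical {γ : ℝ} (hγ : 0 < γ) :
    Continuous fun y : ℝ => Complex.Gamma (γ + y * Complex.I) := by
  refine continuous_iff_continuousAt.2 fun y => ?_
  refine (Complex.continuousAt_Gamma _ fun m h => ?_).comp (f := fun y : ℝ => (γ + y * Complex.I : ℂ))
    (by fun_prop)
  have := congrArg Complex.re h
  simp at this
  have : (0 : ℝ) ≤ m := m.cast_nonneg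
  linarith

theorem integrable_exp_neg_mul_abs {b : ℝ} (hb : 0 < b) :
    Integrable fun y : ℝ => Real.exp (-(b * |y|)) := by
  have h : IntegrableOn (fun y : ℝ => Real.exp (-(b * |y|))) (Set.Ioi 0) := by
    refine (integrableOn_exp_mul_Ioi (a := -b) (by linarith) 0).congr_fun (fun y hy => ?_)
      measurableSet_Ioi
    simp [abs_of_pos (Set.mem_Ioi.1 hy)]
  rw [← integrableOn_univ, ← Set.Iic_union_Ioi (a := (0 : ℝ)), integrableOn_union]
  refine ⟨?_, h⟩
  rw [← neg_zero, ← integrableOn_Ici_iff_integrableOn_Ioi] at h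
  refine h.comp_neg_Iic.congr_fun (fun y _ => ?_) measurableSet_Iic
  simp only [abs_neg]

/-- The power grows at most like `e^{|arg B||y|}` with `|arg B| < π/2`; the decay rate of Γ is
chosen halfway between `|arg B|` and `π/2`. -/
theorem integrable_Gamma_mul_cpow_vertical {γ : ℝ} (hγ : 0 < γ) {B : ℂ} (hB : 0 < B.re) :
    Integrable fun y : ℝ =>
      B ^ (-(γ + y * Complex.I : ℂ)) * Complex.Gamma (γ + y * Complex.I) := by
  have hB0 : B ≠ 0 := fun h => by simp [h] at hB
  have harg : |B.arg| < Real.pi / 2 := Complex.abs_arg_lt_pi_div_two_iff.2 (Or.inl hB)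
  obtain ⟨C, hC⟩ := exists_norm_Gamma_le_exp hγ (θ := (|B.arg| + Real.pi / 2) / 2)
    (by positivity) (by linarith)
  refine ((integrable_exp_neg_mul_abs (b := (Real.pi / 2 - |B.arg|) / 2) (by linarith)).const_mul
    (‖B‖ ^ (-γ) * C)).mono' ?_ (.of_forall fun y => ?_)
  · refine Continuous.aestronglyMeasurable (.mul ?_ (continuous_Gamma_vertical hγ))
    exact Continuous.const_cpow (by fun_prop) (Or.inl hB0)
  · rw [norm_mul, Complex.norm_cpow_of_ne_zero hB0]
    have h1 : ‖B‖ ^ (-(γ + y * Complex.I : ℂ)).re / Real.exp (B.arg * (-(γ + y * Complex.I : ℂ)).im)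
        ≤ ‖B‖ ^ (-γ) * Real.exp (|B.arg| * |y|) := by
      rw [div_eq_mul_inv, ← Real.exp_neg]
      simp only [Complex.neg_re, Complex.add_re, Complex.ofReal_re, Complex.re_ofReal_mul,
        Complex.I_re, mul_zero, add_zero, Complex.neg_im, Complex.add_im, Complex.ofReal_im,
        Complex.im_ofReal_mul, Complex.I_im, mul_one, zero_add, mul_neg, neg_neg]
      have : B.arg * y ≤ |B.arg| * |y| := by rw [← abs_mul]; exact le_abs_self _
      gcongr
    refine (mul_le_mul h1 (hC y) (norm_nonneg _) (by positivity)).trans_eq ?_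
    rw [mul_mul_mul_comm, ← Real.exp_add]
    ring_nf

/-- The Mellin-Barnes representation of the exponential. -/
theorem integral_Gamma_mul_cpow_vertical {γ : ℝ} (hγ : 0 < γ) {B : ℂ} (hB : 0 < B.re) {x : ℝ}
    (hx : 0 < x) :
    (1 / (2 * Real.pi : ℂ)) * ∫ y : ℝ, (x : ℂ) ^ (-(γ + y * Complex.I : ℂ)) *
      (B ^ (-(γ + y * Complex.I : ℂ)) * Complex.Gamma (γ + y * Complex.I)) =
      Complex.exp (-(B * x)) := by
  have hmellin : ∀ y : ℝ, mellin (fun x : ℝ => Complex.exp (-(B * x))) (γ + y * Complex.I) =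
      B ^ (-(γ + y * Complex.I : ℂ)) * Complex.Gamma (γ + y * Complex.I) := fun y =>
    integral_cpow_mul_exp_neg_mul_Ioi_of_re_pos (by simpa using hγ) hB
  have h := mellinInv_mellin_eq γ (fun x : ℝ => Complex.exp (-(B * x))) hx
    (integrableOn_cpow_mul_exp_neg_mul (a := γ) (by simpa using hγ) hB)
    (by
      refine (integrable_Gamma_mul_cpow_vertical hγ hB).congr (.of_forall fun y => ?_)
      exact (hmellin y).symm)
    (by fun_prop)
  rw [← h, mellinInv]
  simp only [hmellin, smul_eq_mul, Complex.real_smul]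
  push_cast
  rfl

/-! ### Fox's function as a Laplace integral. -/

/-- The argument condition keeps `arg B - β arg E` inside `(-π, π)`, so `log B - β log E` is the
principal logarithm of the product. -/
theorem mul_cpow_cpow_of_arg {B E : ℂ} (hB : B ≠ 0) (hE : E ≠ 0) {β : ℝ} (hβ : 0 ≤ β)
    (harg : |B.arg| + β * |E.arg| < Real.pi) (v : ℂ) :
    (B * E ^ ((-β : ℝ) : ℂ)) ^ (-v) = B ^ (-v) * E ^ (β * v) := by
  have hz : B * E ^ ((-β : ℝ) : ℂ) = Complex.exp (Complex.log B + Complex.log E * (-β : ℝ)) := by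
    rw [Complex.exp_add, Complex.exp_log hB, Complex.cpow_def_of_ne_zero hE]
  have him : (Complex.log B + Complex.log E * (-β : ℝ)).im = B.arg - β * E.arg := by
    rw [Complex.add_im, Complex.im_mul_ofReal, Complex.log_im, Complex.log_im]
    ring
  have hlt : |B.arg - β * E.arg| < Real.pi := by
    refine (abs_sub _ _).trans_lt ?_
    rwa [abs_mul, abs_of_nonneg hβ]
  have hlt' := abs_lt.1 hlt
  have hlog : Complex.log (B * E ^ ((-β : ℝ) : ℂ)) = Complex.log B + Complex.log E * (-β : ℝ) := by
    rw [hz, Complex.log_exp] <;> rw [him]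
    exacts [hlt'.1, hlt'.2.le]
  rw [Complex.cpow_def_of_ne_zero (by rw [hz]; exact Complex.exp_ne_zero _), hlog,
    Complex.cpow_def_of_ne_zero hB, Complex.cpow_def_of_ne_zero hE, ← Complex.exp_add]
  push_cast
  ring_nf

theorem ofReal_rpow_cpow {x : ℝ} (hx : 0 < x) (β : ℝ) (v : ℂ) :
    ((x ^ β : ℝ) : ℂ) ^ v = (x : ℂ) ^ (β * v) := by
  rw [Complex.cpow_def_of_ne_zero (by exact_mod_cast (Real.rpow_pos_of_pos hx β).ne'),
    Complex.cpow_def_of_ne_zero (by exact_mod_cast hx.ne'),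
    ← Complex.ofReal_log (Real.rpow_pos_of_pos hx β).le, ← Complex.ofReal_log hx.le,
    Real.log_rpow hx]
  push_cast
  ring_nf

/-- Supplies Fubini: the modulus is a product of a function of x and one of y, and `β γ < 1` gives
integrability at `x = 0`. -/
theorem integrable_prod_laplace_mellinBarnes {β γ : ℝ} (hγ : 0 < γ) (hβγ : β * γ < 1) {B E : ℂ}
    (hB : 0 < B.re) (hE : 0 < E.re) :
    Integrable (fun p : ℝ × ℝ =>
      ((p.1 : ℂ) ^ ((1 - β * (γ + p.2 * Complex.I)) - 1 : ℂ) * Complex.exp (-(E * p.1))) *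
        (B ^ (-(γ + p.2 * Complex.I : ℂ)) * Complex.Gamma (γ + p.2 * Complex.I)))
      ((volume.restrict (Set.Ioi (0 : ℝ))).prod volume) := by
  have hB0 : B ≠ 0 := fun h => by simp [h] at hB
  refine ((integrableOn_rpow_mul_exp_neg_mul (s := -(β * γ)) (by linarith) hE).mul_prod
    (integrable_Gamma_mul_cpow_vertical hγ hB).norm).mono' ?_ ?_
  · refine AEStronglyMeasurable.mul
      (by fun_prop : Measurable _).aestronglyMeasurable ?_
    refine Continuous.aestronglyMeasurable (.mul ?_ ?_)
    · exact Continuous.const_cpow (by fun_prop) (Or.inl hB0)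
    · exact (continuous_Gamma_vertical hγ).comp continuous_snd
  · have h0 : ∀ᵐ p : ℝ × ℝ ∂((volume.restrict (Set.Ioi (0 : ℝ))).prod volume), 0 < p.1 :=
      Measure.quasiMeasurePreserving_fst.ae (ae_restrict_mem measurableSet_Ioi)
    filter_upwards [h0] with p hp
    rw [norm_mul, norm_ofReal_cpow_sub_one_mul_exp_neg hp]
    simp

theorem foxIntegrand_one_one {β γ : ℝ} (z : ℂ) (y : ℝ) :
    foxIntegrand 1 1 ![0] ![β] ![0] ![1] z γ y =
      Complex.Gamma (γ + y * Complex.I) * Complex.Gamma (1 - β * (γ + y * Complex.I)) *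
        z ^ (-(γ + y * Complex.I : ℂ)) := by
  simp [foxIntegrand, foxKernel]

theorem foxIntegrand_eq_laplace {β γ : ℝ} (hβ : 0 ≤ β) (hβγ : β * γ < 1) {B E : ℂ}
    (hB : 0 < B.re) (hE : 0 < E.re) (harg : |B.arg| + β * |E.arg| < Real.pi) (y : ℝ) :
    foxIntegrand 1 1 ![0] ![β] ![0] ![1] (B * E ^ ((-β : ℝ) : ℂ)) γ y =
      E * ∫ x : ℝ in Set.Ioi 0,
        ((x : ℂ) ^ ((1 - β * (γ + y * Complex.I)) - 1 : ℂ) * Complex.exp (-(E * x))) *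
          (B ^ (-(γ + y * Complex.I : ℂ)) * Complex.Gamma (γ + y * Complex.I)) := by
  have hB0 : B ≠ 0 := fun h => by simp [h] at hB
  have hE0 : E ≠ 0 := fun h => by simp [h] at hE
  rw [foxIntegrand_one_one, mul_cpow_cpow_of_arg hB0 hE0 hβ harg, integral_mul_const,
    integral_cpow_mul_exp_neg_mul_Ioi_of_re_pos (by simpa using hβγ) hE]
  rw [neg_sub, Complex.cpow_sub _ _ hE0, Complex.cpow_one]
  field_simp

theorem foxLineIntegral_eq_laplace {β γ : ℝ} (hβ : 0 ≤ β) (hγ : 0 < γ) (hβγ : β * γ < 1) {B E : ℂ}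
    (hB : 0 < B.re) (hE : 0 < E.re) (harg : |B.arg| + β * |E.arg| < Real.pi) :
    Integrable (foxIntegrand 1 1 ![0] ![β] ![0] ![1] (B * E ^ ((-β : ℝ) : ℂ)) γ) ∧
    foxLineIntegral 1 1 ![0] ![β] ![0] ![1] (B * E ^ ((-β : ℝ) : ℂ)) γ =
      E * ∫ x : ℝ in Set.Ioi 0, Complex.exp (-(E * x) - B * (x ^ β : ℝ)) := by
  have hint := integrable_prod_laplace_mellinBarnes hγ hβγ hB hE
  have heq := funext (foxIntegrand_eq_laplace (γ := γ) hβ hβγ hB hE harg)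
  refine ⟨?_, ?_⟩
  · rw [heq]
    exact hint.integral_prod_right.const_mul E
  · rw [foxLineIntegral, heq, integral_const_mul, ← integral_integral_swap hint, mul_left_comm,
      ← integral_const_mul]
    congr 1
    refine setIntegral_congr_fun measurableSet_Ioi fun x (hx : 0 < x) => ?_
    -- After the exchange, the y-integral is Mellin inversion evaluated at `x^β`.
    have h := integral_Gamma_mul_cpow_vertical hγ hB (Real.rpow_pos_of_pos hx β)
    simp only [sub_eq_add_neg (-(E * (x : ℂ))), Complex.exp_add]
    rw [← h, mul_left_comm, ← integral_const_mul (Complex.exp _)]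
    congr 2 with y
    rw [ofReal_rpow_cpow hx, mul_neg, sub_sub_cancel_left]
    ring

/-- The poles lie at `-i` and `(1 + i)/β`; only `i = 0` is binding in each family. -/
theorem foxSeparates_iff {β γ : ℝ} (hβ : 0 < β) :
    FoxSeparates 1 1 ![0] ![β] ![0] ![1] γ ↔ 0 < γ ∧ β * γ < 1 := by
  have hre : ∀ i : ℕ, ((1 + i : ℂ) / β).re = (1 + i) / β := fun i => by
    rw [Complex.div_ofReal_re]; simp
  simp only [FoxSeparates, Fin.forall_fin_one, Matrix.cons_val_fin_one, Fin.val_zero, zero_add,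
    sub_zero, hre, zero_lt_one, forall_true_left]
  constructor
  · rintro ⟨h1, h2⟩
    have h2 := h2 0
    rw [lt_div_iff₀ hβ] at h2
    exact ⟨by simpa using h1 0, by simpa [mul_comm] using h2⟩
  · rintro ⟨h1, h2⟩
    refine ⟨fun i => ?_, fun i => ?_⟩
    · simp
      have : (0 : ℝ) ≤ i := i.cast_nonneg
      linarith
    · rw [lt_div_iff₀ hβ]
      have : (0 : ℝ) ≤ i := i.cast_nonneg
      linarith

/-- The Laplace integral does not involve γ, so the line picked by choice is immaterial. -/
theorem foxH_eq_laplace {β : ℝ} (hβ : 0 < β) {B E : ℂ}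
    (hB : 0 < B.re) (hE : 0 < E.re) (harg : |B.arg| + β * |E.arg| < Real.pi) :
    FoxHWellDefined 1 1 ![0] ![β] ![0] ![1] (B * E ^ ((-β : ℝ) : ℂ)) ∧
    foxH 1 1 ![0] ![β] ![0] ![1] (B * E ^ ((-β : ℝ) : ℂ)) =
      E * ∫ x : ℝ in Set.Ioi 0, Complex.exp (-(E * x) - B * (x ^ β : ℝ)) := by
  have hex : ∃ γ : ℝ, FoxSeparates 1 1 ![0] ![β] ![0] ![1] γ :=
    ⟨1 / (2 * β), (foxSeparates_iff hβ).2 ⟨by positivity, by field_simp; norm_num⟩⟩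
  have hline : ∀ γ : ℝ, FoxSeparates 1 1 ![0] ![β] ![0] ![1] γ → _ := fun γ h =>
    foxLineIntegral_eq_laplace hβ.le ((foxSeparates_iff hβ).1 h).1 ((foxSeparates_iff hβ).1 h).2
      hB hE harg
  have hH : foxH 1 1 ![0] ![β] ![0] ![1] (B * E ^ ((-β : ℝ) : ℂ)) =
      E * ∫ x : ℝ in Set.Ioi 0, Complex.exp (-(E * x) - B * (x ^ β : ℝ)) := by
    rw [foxH, dif_pos hex]
    exact (hline _ hex.choose_spec).2
  exact ⟨⟨hex, fun γ h => ⟨(hline γ h).1, (hline γ h).2.trans hH.symm⟩⟩, hH⟩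

/-! ### Perturbation of the Laplace integral for small B. -/

/-- Mean value inequality on the convex left half plane, where the derivative has norm at most 1. -/
theorem norm_exp_sub_one_le_of_re_nonpos {z : ℂ} (hz : z.re ≤ 0) : ‖Complex.exp z - 1‖ ≤ ‖z‖ := by
  have h := (convex_halfSpace_re_le 0).norm_image_sub_le_of_norm_hasDerivWithin_le
    (f := Complex.exp) (f' := Complex.exp) (C := 1) (x := 0) (y := z)
    (fun w _ => (Complex.hasDerivAt_exp w).hasDerivWithinAt)
    (fun w (hw : w.re ≤ 0) => by rw [Complex.norm_exp]; exact Real.exp_le_one_iff.2 hw)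
    (show (0 : ℂ).re ≤ 0 by simp) hz
  simpa using h

theorem norm_exp_neg_mul_le {E : ℂ} {e₀ x : ℝ} (h : e₀ ≤ E.re) (hx : 0 ≤ x) :
    ‖Complex.exp (-(E * x))‖ ≤ Real.exp (-(e₀ * x)) := by
  rw [Complex.norm_exp]
  simp only [Complex.neg_re, Complex.re_mul_ofReal]
  gcongr

theorem integrableOn_exp_neg_mul_sub {E B : ℂ} (hE : 0 < E.re) (hB : 0 ≤ B.re) (β : ℝ) :
    IntegrableOn (fun x : ℝ => Complex.exp (-(E * x) - B * (x ^ β : ℝ))) (Set.Ioi 0) := by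
  refine (integrableOn_rpow_mul_exp_neg_mul (s := 0) (by norm_num) hE).mono'
    (by fun_prop : Measurable _).aestronglyMeasurable ?_
  filter_upwards [ae_restrict_mem measurableSet_Ioi] with x (hx : 0 < x)
  rw [sub_eq_add_neg, Complex.exp_add, norm_mul, Real.rpow_zero, one_mul]
  refine (mul_le_of_le_one_right (norm_nonneg _) ?_).trans (norm_exp_neg_mul_le le_rfl hx.le)
  rw [Complex.norm_exp, Real.exp_le_one_iff, Complex.neg_re, Complex.re_mul_ofReal]
  have := Real.rpow_nonneg hx.le β
  nlinarith [mul_nonneg hB this]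

theorem integral_exp_neg_mul_Ioi {E : ℂ} (hE : 0 < E.re) :
    ∫ x : ℝ in Set.Ioi 0, Complex.exp (-(E * x)) = E⁻¹ := by
  have h := integral_cpow_mul_exp_neg_mul_Ioi_of_re_pos (a := 1) (by simp) hE
  simpa [Complex.cpow_neg] using h

/-- First-order perturbation bound for the Laplace integral. -/
theorem norm_laplace_sub_inv_le {β e₀ : ℝ} (hβ : 0 < β) (he₀ : 0 < e₀) {E B : ℂ} (hE : e₀ ≤ E.re)
    (hB : 0 ≤ B.re) :
    ‖(∫ x : ℝ in Set.Ioi 0, Complex.exp (-(E * x) - B * (x ^ β : ℝ))) - E⁻¹‖ ≤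
      ‖B‖ * ∫ x : ℝ in Set.Ioi 0, x ^ β * Real.exp (-(e₀ * x)) := by
  have hE' := he₀.trans_le hE
  have h0 : IntegrableOn (fun x : ℝ => Complex.exp (-(E * x))) (Set.Ioi 0) := by
    simpa using integrableOn_exp_neg_mul_sub (B := 0) hE' (by simp) β
  rw [← integral_exp_neg_mul_Ioi hE',
    ← integral_sub (integrableOn_exp_neg_mul_sub hE' hB β) h0, ← integral_const_mul]
  refine norm_integral_le_of_norm_le
    ((integrableOn_rpow_mul_exp_neg_mul (by linarith) he₀).const_mul _) ?_
  filter_upwards [ae_restrict_mem measurableSet_Ioi] with x (hx : 0 < x)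
  have hxβ := Real.rpow_nonneg hx.le β
  have h1 : ‖Complex.exp (-(B * (x ^ β : ℝ))) - 1‖ ≤ ‖B‖ * x ^ β := by
    refine (norm_exp_sub_one_le_of_re_nonpos ?_).trans_eq ?_
    · rw [Complex.neg_re, Complex.re_mul_ofReal]
      nlinarith [mul_nonneg hB hxβ]
    · rw [norm_neg, norm_mul, Complex.norm_real, Real.norm_of_nonneg hxβ]
  rw [sub_eq_add_neg (-(E * x)), Complex.exp_add, ← mul_sub_one, norm_mul, mul_comm, ← mul_assoc]
  exact mul_le_mul h1 (norm_exp_neg_mul_le hE hx.le) (norm_nonneg _) (by positivity)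

/-! ### Distribution and density of order statistics. -/

/-- The probability that a binomial variable with `n` trials is at least `r`. -/
noncomputable def binomialTail (n r : ℕ) (p : ℝ) : ℝ :=
  ∑ j ∈ Finset.Ico r (n + 1), n.choose j * (p ^ j * (1 - p) ^ (n - j))

/-- The identity `(j+1) C(n,j+1) = (n-j) C(n,j)` puts the derivative in the form `a_j - a_{j+1}`, so
that the sum over j telescopes. The top term vanishes with `C(n,n+1)`. -/
theorem hasDerivAt_choose_mul_pow (n j : ℕ) (p : ℝ) :
    HasDerivAt (fun p : ℝ => n.choose j * (p ^ j * (1 - p) ^ (n - j)))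
      (j * n.choose j * (p ^ (j - 1) * (1 - p) ^ (n - j)) -
        (j + 1 : ℕ) * n.choose (j + 1) * (p ^ (j + 1 - 1) * (1 - p) ^ (n - (j + 1)))) p := by
  have h1 : HasDerivAt (fun p : ℝ => (1 - p) ^ (n - j))
      ((n - j : ℕ) * (1 - p) ^ (n - j - 1) * (-1)) p := by
    simpa using! ((hasDerivAt_id p).const_sub 1).pow (n - j)
  refine (((hasDerivAt_pow j p).mul h1).const_mul (n.choose j : ℝ)).congr_deriv ?_
  have h2 : (n.choose (j + 1) : ℝ) * (j + 1 : ℕ) = n.choose j * (n - j : ℕ) := by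
    exact_mod_cast Nat.choose_succ_right_eq n j
  rw [mul_comm ((j + 1 : ℕ) : ℝ), h2, add_tsub_cancel_right, Nat.sub_add_eq]
  ring

theorem hasDerivAt_binomialTail {n r : ℕ} (hr : r ≤ n) (p : ℝ) :
    HasDerivAt (binomialTail n r)
      (r * n.choose r * (p ^ (r - 1) * (1 - p) ^ (n - r))) p := by
  have h := HasDerivAt.fun_sum (u := Finset.Ico r (n + 1))
    (fun j _ => hasDerivAt_choose_mul_pow n j p)
  refine h.congr_deriv ?_
  have := Finset.sum_Ico_sub
    (fun j => -((j : ℝ) * n.choose j * (p ^ (j - 1) * (1 - p) ^ (n - j)))) (Nat.le_succ_of_le hr)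
  simp only [sub_neg_eq_add, neg_add_eq_sub] at this
  rw [this]
  simp

theorem binomialTail_zero {n r : ℕ} (hr : 1 ≤ r) : binomialTail n r 0 = 0 := by
  refine Finset.sum_eq_zero fun j hj => ?_
  have := (Finset.mem_Ico.1 hj).1
  rw [zero_pow (by omega)]
  simp

/-- Sorting preserves the count of entries below x, and in a sorted vector these form an initial
segment. -/
theorem orderStat_le_iff {n r : ℕ} (hr : 1 ≤ r) (hrn : r ≤ n) (v : Fin n → ℝ) (x : ℝ) :
    orderStat v r ≤ x ↔ r ≤ (Finset.univ.filter fun i => v i ≤ x).card := by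
  have h := Tuple.lt_card_le_iff_apply_le_of_monotone (a := x) (j := ⟨r - 1, by omega⟩)
    (Tuple.monotone_sort v)
  have hcard : (Finset.univ.filter fun i => (v ∘ Tuple.sort v) i ≤ x).card =
      (Finset.univ.filter fun i => v i ≤ x).card := by
    refine Finset.card_bij (fun i _ => Tuple.sort v i) (by simp) (by simp) fun i hi =>
      ⟨(Tuple.sort v).symm i, by simpa using hi, by simp⟩
  rw [orderStat, dif_pos ⟨hr, hrn⟩]
  rw [hcard] at h
  refine h.symm.trans ?_
  simp only
  omega

/-- Prescribing exactly which coordinates are at most x gives a box, whose product measure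
factorizes. -/
theorem setOf_filter_le_eq {n : ℕ} (S : Finset (Fin n)) (x : ℝ) :
    {v : Fin n → ℝ | (Finset.univ.filter fun i => v i ≤ x) = S} =
      Set.univ.pi fun i => if i ∈ S then Set.Iic x else Set.Ioi x := by
  ext v
  simp only [Set.mem_ofPred_eq, Finset.ext_iff, Finset.mem_filter, Finset.mem_univ, true_and,
    Set.mem_univ_pi]
  refine forall_congr' fun i => ?_
  by_cases h : i ∈ S <;> simp [h]

theorem setOf_orderStat_le_eq {n r : ℕ} (hr : 1 ≤ r) (hrn : r ≤ n) (x : ℝ) :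
    {v : Fin n → ℝ | orderStat v r ≤ x} =
      ⋃ S ∈ Finset.univ.filter fun S : Finset (Fin n) => r ≤ S.card,
        {v : Fin n → ℝ | (Finset.univ.filter fun i => v i ≤ x) = S} := by
  ext v
  simp [orderStat_le_iff hr hrn]

theorem measurableSet_setOf_filter_le_eq {n : ℕ} (S : Finset (Fin n)) (x : ℝ) :
    MeasurableSet {v : Fin n → ℝ | (Finset.univ.filter fun i => v i ≤ x) = S} := by
  rw [setOf_filter_le_eq]
  refine MeasurableSet.univ_pi fun i => ?_
  split_ifs
  exacts [measurableSet_Iic, measurableSet_Ioi]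

theorem measurable_orderStat {n r : ℕ} (hr : 1 ≤ r) (hrn : r ≤ n) :
    Measurable fun v : Fin n → ℝ => orderStat v r := by
  refine measurable_of_Iic fun x => ?_
  change MeasurableSet {v : Fin n → ℝ | orderStat v r ≤ x}
  rw [setOf_orderStat_le_eq hr hrn]
  exact Finset.measurableSet_biUnion _ fun S _ => measurableSet_setOf_filter_le_eq S x

theorem pi_real_setOf_filter_le_eq {n : ℕ} (ν : Measure ℝ) [IsProbabilityMeasure ν]
    (S : Finset (Fin n)) (x : ℝ) :
    (Measure.pi fun _ : Fin n => ν).real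
        {v : Fin n → ℝ | (Finset.univ.filter fun i => v i ≤ x) = S} =
      ν.real (Set.Iic x) ^ S.card * (1 - ν.real (Set.Iic x)) ^ (n - S.card) := by
  have hc : ν.real (Set.Ioi x) = 1 - ν.real (Set.Iic x) := by
    rw [← Set.compl_Iic, probReal_compl_eq_one_sub measurableSet_Iic]
  rw [setOf_filter_le_eq, Measure.real, Measure.pi_pi, ENNReal.toReal_prod]
  have : ∀ i, (ν (if i ∈ S then Set.Iic x else Set.Ioi x)).toReal =
      if i ∈ S then ν.real (Set.Iic x) else 1 - ν.real (Set.Iic x) := fun i => by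
    split_ifs
    exacts [rfl, hc]
  simp only [this, Finset.prod_ite, Finset.prod_const, Finset.filter_mem_eq_inter,
    Finset.univ_inter]
  rw [Finset.filter_not, Finset.filter_mem_eq_inter, Finset.univ_inter, ← Finset.compl_eq_univ_sdiff,
    Finset.card_compl, Fintype.card_fin]

/-- The distribution function of an order statistic of an independent sample. -/
theorem pi_real_orderStat_le {n r : ℕ} (hr : 1 ≤ r) (hrn : r ≤ n) (ν : Measure ℝ)
    [IsProbabilityMeasure ν] (x : ℝ) :
    (Measure.pi fun _ : Fin n => ν).real {v : Fin n → ℝ | orderStat v r ≤ x} =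
      binomialTail n r (ν.real (Set.Iic x)) := by
  rw [setOf_orderStat_le_eq hr hrn, measureReal_biUnion_finset
    (fun S _ T _ hST => Set.disjoint_left.2 fun v hS hT => hST (hS.symm.trans hT))
    (fun S _ => measurableSet_setOf_filter_le_eq S x)]
  simp only [pi_real_setOf_filter_le_eq]
  rw [Finset.sum_filter, ← Finset.powerset_univ, Finset.sum_powerset_apply_card
    (fun m => if r ≤ m then ν.real (Set.Iic x) ^ m * (1 - ν.real (Set.Iic x)) ^ (n - m) else 0),
    Finset.card_univ, Fintype.card_fin, binomialTail]
  simp only [nsmul_eq_mul, mul_ite, mul_zero]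
  rw [← Finset.sum_filter]
  refine Finset.sum_congr ?_ fun _ _ => rfl
  ext j
  simp [and_comm]

/-- A density on the half line is determined by a primitive. -/
theorem withDensity_Iic_of_hasDerivAt {G g : ℝ → ℝ} (hG : ∀ x, HasDerivAt G (g x) x)
    (hg : Continuous g) (hg0 : ∀ x, 0 ≤ x → 0 ≤ g x) (hG0 : G 0 = 0) (x : ℝ) :
    (volume.withDensity fun y => ENNReal.ofReal (if 0 ≤ y then g y else 0)) (Set.Iic x) =
      ENNReal.ofReal (G (max x 0)) := by
  have hind : (fun y => ENNReal.ofReal (if 0 ≤ y then g y else 0)) =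
      (Set.Ici 0).indicator fun y => ENNReal.ofReal (g y) := by
    ext y
    by_cases h : 0 ≤ y <;> simp [h]
  rw [withDensity_apply _ measurableSet_Iic, hind, setLIntegral_indicator measurableSet_Ici,
    Set.Ici_inter_Iic, ← restrict_Ioc_eq_restrict_Icc]
  rcases le_total x 0 with h | h
  · simp [h, hG0]
  · rw [max_eq_left h, ← ofReal_integral_eq_lintegral_ofReal
      ((hg.integrableOn_Icc).mono_set Set.Ioc_subset_Icc_self)
      ((ae_restrict_mem measurableSet_Ioc).mono fun y hy => hg0 y hy.1.le),
      ← intervalIntegral.integral_of_le h,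
      intervalIntegral.integral_eq_sub_of_hasDerivAt (fun y _ => hG y)
        (hg.intervalIntegrable _ _), hG0, sub_zero]

theorem hasDerivAt_one_sub_exp_neg_sq (a x : ℝ) :
    HasDerivAt (fun x : ℝ => 1 - Real.exp (-(a * x ^ 2)))
      (2 * a * x * Real.exp (-(a * x ^ 2))) x := by
  refine ((((hasDerivAt_pow 2 x).const_mul a).fun_neg.exp).const_sub 1).congr_deriv ?_
  push_cast
  ring

theorem distLaw_Iic {c lam : ℝ} (hc : 0 < c) (hlam : 0 < lam) (x : ℝ) :
    (distLaw c lam).real (Set.Iic x) =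
      1 - Real.exp (-(c * lam * Real.pi * (max x 0) ^ 2)) := by
  have h := withDensity_Iic_of_hasDerivAt (hasDerivAt_one_sub_exp_neg_sq (c * lam * Real.pi))
    (by fun_prop) (fun y hy => by positivity) (by simp) x
  have hd : distLaw c lam = volume.withDensity fun y => ENNReal.ofReal
      (if 0 ≤ y then 2 * (c * lam * Real.pi) * y *
        Real.exp (-(c * lam * Real.pi * y ^ 2)) else 0) := by
    simp only [distLaw, distPDF, mul_assoc]
  rw [Measure.real, hd, h, ENNReal.toReal_ofReal]
  rw [sub_nonneg, Real.exp_le_one_iff]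
  have : 0 ≤ c * lam * Real.pi * max x 0 ^ 2 := by positivity
  linarith

/-- The density of the `r`-th order statistic of `n` independent variables with distribution
function `1 - exp (-a x²)` on the half line. -/
noncomputable def orderStatDensity (n r : ℕ) (a x : ℝ) : ℝ :=
  r * n.choose r * ((1 - Real.exp (-(a * x ^ 2))) ^ (r - 1) *
    (1 - (1 - Real.exp (-(a * x ^ 2)))) ^ (n - r)) * (2 * a * x * Real.exp (-(a * x ^ 2)))

theorem continuous_orderStatDensity (n r : ℕ) (a : ℝ) : Continuous (orderStatDensity n r a) := by
  unfold orderStatDensity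
  fun_prop

theorem orderStatDensity_nonneg {n r : ℕ} {a x : ℝ} (ha : 0 ≤ a) (hx : 0 ≤ x) :
    0 ≤ orderStatDensity n r a x := by
  have h : 0 ≤ 1 - Real.exp (-(a * x ^ 2)) := by
    rw [sub_nonneg, Real.exp_le_one_iff]
    have : 0 ≤ a * x ^ 2 := by positivity
    linarith
  rw [orderStatDensity, sub_sub_cancel]
  positivity

theorem map_orderStat_pi_distLaw {n r : ℕ} (hr : 1 ≤ r) (hrn : r ≤ n) {c lam : ℝ} (hc : 0 < c)
    (hlam : 0 < lam) [IsProbabilityMeasure (distLaw c lam)] :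
    (Measure.pi fun _ : Fin n => distLaw c lam).map (fun v => orderStat v r) =
      volume.withDensity fun x => ENNReal.ofReal
        (if 0 ≤ x then orderStatDensity n r (c * lam * Real.pi) x else 0) := by
  have hmeas := measurable_orderStat hr hrn
  have : IsProbabilityMeasure
      ((Measure.pi fun _ : Fin n => distLaw c lam).map (fun v => orderStat v r)) :=
    Measure.isProbabilityMeasure_map hmeas.aemeasurable
  refine Measure.ext_of_Iic _ _ fun x => ?_
  rw [withDensity_Iic_of_hasDerivAt
    (G := fun x => binomialTail n r (1 - Real.exp (-(c * lam * Real.pi * x ^ 2))))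
    (g := orderStatDensity n r (c * lam * Real.pi))
    (fun x => (hasDerivAt_binomialTail hrn _).comp x (hasDerivAt_one_sub_exp_neg_sq _ x))
    (continuous_orderStatDensity n r _) (fun x hx => orderStatDensity_nonneg (by positivity) hx)
    (by simp [binomialTail_zero hr]), ← distLaw_Iic hc hlam, ← pi_real_orderStat_le hr hrn,
    Measure.map_apply hmeas measurableSet_Iic, ofReal_measureReal]
  rfl

theorem hasLaw_orderStat {Ω : Type*} [MeasurableSpace Ω] {μ : Measure Ω} [IsProbabilityMeasure μ]
    {n r : ℕ} (hr : 1 ≤ r) (hrn : r ≤ n) {c lam : ℝ} (hc : 0 < c) (hlam : 0 < lam)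
    {d : Fin n → Ω → ℝ} (hindep : iIndepFun d μ) (hlaw : ∀ i, HasLaw (d i) (distLaw c lam) μ) :
    HasLaw (fun x => orderStat (fun i => d i x) r)
      (volume.withDensity fun x => ENNReal.ofReal
        (if 0 ≤ x then orderStatDensity n r (c * lam * Real.pi) x else 0)) μ := by
  -- Since `1 ≤ r ≤ n` there is a user 0, whose law forces the density to have total mass 1.
  have hprob : IsProbabilityMeasure (distLaw c lam) :=
    (hlaw ⟨0, by omega⟩).isProbabilityMeasure_iff.1 inferInstance
  have hjoint : HasLaw (fun x i => d i x) (Measure.pi fun _ : Fin n => distLaw c lam) μ := by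
    refine ⟨aemeasurable_pi_lambda _ fun i => (hlaw i).aemeasurable, ?_⟩
    rw [hindep.map_fun_eq_pi_map fun i => (hlaw i).aemeasurable]
    simp only [(hlaw _).map_eq]
  have horder : HasLaw (fun v : Fin n → ℝ => orderStat v r) _
      (Measure.pi fun _ : Fin n => distLaw c lam) :=
    ⟨(measurable_orderStat hr hrn).aemeasurable, map_orderStat_pi_distLaw hr hrn hc hlam⟩
  exact horder.fun_comp hjoint

theorem integral_withDensity_half_line {g : ℝ → ℝ} (hg : Continuous g)
    (hg0 : ∀ x, 0 ≤ x → 0 ≤ g x) (f : ℝ → ℂ) :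
    ∫ x, f x ∂(volume.withDensity fun x => ENNReal.ofReal (if 0 ≤ x then g x else 0)) =
      ∫ x in Set.Ioi 0, (g x : ℂ) * f x := by
  have hm : Measurable fun x => if 0 ≤ x then g x else 0 :=
    Measurable.ite measurableSet_Ici hg.measurable measurable_const
  rw [integral_withDensity_eq_integral_toReal_smul hm.ennreal_ofReal
    (.of_forall fun x => ENNReal.ofReal_lt_top), ← integral_Ici_eq_integral_Ioi,
    ← integral_indicator measurableSet_Ici]
  congr 1 with x
  by_cases h : 0 ≤ x
  · simp [h, ENNReal.toReal_ofReal (hg0 x h)]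
  · simp [h]

/-! ### Arguments in the right half plane. -/

theorem arg_cpow_ofReal {w : ℂ} (hw : w ≠ 0) {q : ℝ} (hq : |w.arg * q| < Real.pi) :
    (w ^ (q : ℂ)).arg = w.arg * q := by
  have h := abs_lt.1 hq
  have him : (Complex.log w * q).im = w.arg * q := by rw [Complex.im_mul_ofReal, Complex.log_im]
  rw [← Complex.log_im, Complex.cpow_def_of_ne_zero hw, Complex.log_exp] <;> rw [him]
  exacts [h.1, h.2.le]

theorem arg_eq_arctan {z : ℂ} (hz : 0 < z.re) : z.arg = Real.arctan (z.im / z.re) := by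
  have h := abs_lt.1 (Complex.abs_arg_lt_pi_div_two_iff.2 (Or.inl hz))
  rw [← Complex.tan_arg, Real.arctan_tan h.1 h.2]

theorem abs_arctan (x : ℝ) : |Real.arctan x| = Real.arctan |x| := by
  rcases le_total 0 x with h | h
  · rw [abs_of_nonneg h, abs_of_nonneg (Real.arctan_nonneg.2 h)]
  · rw [abs_of_nonpos h, Real.arctan_neg, abs_of_nonpos]
    simpa using Real.arctan_mono h

/-- Compare tangents: `ω |Im z| / (m + ω Re z) ≤ |Im z| / Re z`. -/
theorem abs_arg_add_mul_le {m ω : ℝ} (hm : 0 < m) (hω : 0 ≤ ω) {z : ℂ} (hz : 0 < z.re) :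
    |(m + ω * z : ℂ).arg| ≤ |z.arg| := by
  have hre : (m + ω * z : ℂ).re = m + ω * z.re := by simp
  have him : (m + ω * z : ℂ).im = ω * z.im := by simp
  have hpos : 0 < m + ω * z.re := by positivity
  rw [arg_eq_arctan (hre ▸ hpos), arg_eq_arctan hz, abs_arctan, abs_arctan]
  refine Real.arctan_mono ?_
  rw [hre, him, abs_div, abs_div, abs_of_pos hpos, abs_of_pos hz, abs_mul, abs_of_nonneg hω,
    div_le_div_iff₀ hpos hz]
  nlinarith [mul_nonneg hm.le (abs_nonneg z.im)]

/-! ### The network quantities and their Laplace integrals. -/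

section Network

variable {N : ℕ} {α lam sigmaSq P rho c : ℝ} {u : EuclideanSpace ℂ (Fin N)} {w : ℂ}

theorem omegaCoeff_nonneg (hα : 2 < α) (hP : 0 < P) (hrho : 0 ≤ rho) :
    0 ≤ omegaCoeff α P rho u := by
  have h : 0 < 1 - 2 / α := by
    rw [sub_pos, div_lt_one (by linarith)]
    exact hα
  have := Real.Gamma_pos_of_pos h
  unfold omegaCoeff
  positivity

theorem abs_arg_cpow_two_div (hα : 2 < α) (hw : 0 < w.re) :
    α / 2 * |(w ^ ((2 / α : ℝ) : ℂ)).arg| = |w.arg| ∧ 0 < (w ^ ((2 / α : ℝ) : ℂ)).re := by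
  have hw0 : w ≠ 0 := fun h => by simp [h] at hw
  have hq : 0 < 2 / α := by positivity
  have hq1 : 2 / α < 1 := by rwa [div_lt_one (by linarith)]
  have harg := Complex.abs_arg_lt_pi_div_two_iff.2 (Or.inl hw)
  have hlt : |w.arg * (2 / α)| < Real.pi / 2 := by
    rw [abs_mul, abs_of_pos hq]
    exact (mul_le_of_le_one_right (abs_nonneg _) hq1.le).trans_lt harg
  have h := arg_cpow_ofReal hw0 (hlt.trans (by linarith [Real.pi_pos]))
  refine ⟨?_, ?_⟩
  · rw [h, abs_mul, abs_of_pos hq]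
    field_simp
  · rw [← h, Complex.abs_arg_lt_pi_div_two_iff] at hlt
    exact hlt.resolve_right (by simp [Complex.cpow_eq_zero_iff, hw0])

theorem rankDenom_eq {K r : ℕ} (hr : r ≤ 2 * K) (l : ℕ) :
    rankDenom K r l c α P rho u w =
      (((2 * K - r + l + 1 : ℕ) * c : ℝ) : ℂ) +
        omegaCoeff α P rho u * w ^ ((2 / α : ℝ) : ℂ) := by
  rw [rankDenom]
  push_cast [Nat.cast_sub hr]
  ring

/-- A bound free of P and `rho`: this is the source of the uniformity in the limit. -/
theorem le_re_rankDenom {K r : ℕ} (hr : r ≤ 2 * K) (l : ℕ) (hc : 0 < c) (hα : 2 < α) (hP : 0 < P)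
    (hrho : 0 ≤ rho) (hw : 0 < w.re) : c ≤ (rankDenom K r l c α P rho u w).re := by
  rw [rankDenom_eq hr, Complex.add_re, Complex.ofReal_re, Complex.re_ofReal_mul]
  have h1 := mul_nonneg (omegaCoeff_nonneg (u := u) hα hP hrho) (abs_arg_cpow_two_div hα hw).2.le
  have h2 : (1 : ℝ) ≤ (2 * K - r + l + 1 : ℕ) := by exact_mod_cast Nat.le_add_left _ _
  nlinarith

theorem mul_abs_arg_rankDenom_le {K r : ℕ} (hr : r ≤ 2 * K) (l : ℕ) (hc : 0 < c) (hα : 2 < α)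
    (hP : 0 < P) (hrho : 0 ≤ rho) (hw : 0 < w.re) :
    α / 2 * |(rankDenom K r l c α P rho u w).arg| ≤ |w.arg| := by
  obtain ⟨h1, h2⟩ := abs_arg_cpow_two_div hα hw
  rw [← h1, rankDenom_eq hr]
  have := abs_arg_add_mul_le (m := (2 * K - r + l + 1 : ℕ) * c) (by positivity)
    (omegaCoeff_nonneg (u := u) hα hP hrho) h2
  gcongr

/-- `∫₀^∞ exp (-π λ D x - (σ² ‖u‖² / P) w x^{α/2}) dx` with `D = rankDenom K r l c α P rho u w`. -/
noncomputable def rankLaplace (K r l : ℕ) (c α lam sigmaSq P rho : ℝ)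
    (u : EuclideanSpace ℂ (Fin N)) (w : ℂ) : ℂ :=
  ∫ x : ℝ in Set.Ioi 0, Complex.exp (-((Real.pi * lam : ℝ) * rankDenom K r l c α P rho u w * x) -
    ((filteredNoise sigmaSq u / P : ℝ) : ℂ) * w * (x ^ (α / 2) : ℝ))

theorem le_re_rate {K r : ℕ} (hr : r ≤ 2 * K) (l : ℕ) (hc : 0 < c) (hα : 2 < α) (hlam : 0 < lam)
    (hP : 0 < P) (hrho : 0 ≤ rho) (hw : 0 < w.re) :
    Real.pi * lam * c ≤ ((Real.pi * lam : ℝ) * rankDenom K r l c α P rho u w).re := by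
  rw [Complex.re_ofReal_mul]
  have := le_re_rankDenom (u := u) hr l hc hα hP hrho hw
  gcongr

theorem foxH_foxArg {K r : ℕ} (hr : r ≤ 2 * K) (l : ℕ) (hc : 0 < c) (hα : 2 < α) (hlam : 0 < lam)
    (hs : 0 < sigmaSq) (hP : 0 < P) (hrho : 0 ≤ rho) (hu : u ≠ 0) (hw : 0 < w.re) :
    FoxHWellDefined 1 1 ![0] ![α / 2] ![0] ![1] (foxArg K r l c α lam sigmaSq P rho u w) ∧
    foxH 1 1 ![0] ![α / 2] ![0] ![1] (foxArg K r l c α lam sigmaSq P rho u w) =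
      (Real.pi * lam : ℝ) * rankDenom K r l c α P rho u w *
        rankLaplace K r l c α lam sigmaSq P rho u w := by
  have hA : 0 < filteredNoise sigmaSq u / P := by
    have := norm_pos_iff.2 hu
    unfold filteredNoise
    positivity
  have hpl : 0 < Real.pi * lam := by positivity
  refine foxH_eq_laplace (by linarith) ?_ ?_ ?_
  · rw [Complex.re_ofReal_mul]
    positivity
  · exact (by positivity : 0 < Real.pi * lam * c).trans_le (le_re_rate hr l hc hα hlam hP hrho hw)
  · rw [Complex.arg_real_mul _ hA, Complex.arg_real_mul _ hpl]
    -- The two terms are each at most `|arg w| < π/2`, so their sum stays below π.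
    have h1 := mul_abs_arg_rankDenom_le (u := u) hr l hc hα hP hrho hw
    have h2 := Complex.abs_arg_lt_pi_div_two_iff.2 (Or.inl hw)
    linarith

theorem filteredNoise_div_mul_re_nonneg (hs : 0 ≤ sigmaSq) (hP : 0 < P) (hw : 0 < w.re) :
    0 ≤ (((filteredNoise sigmaSq u / P : ℝ) : ℂ) * w).re := by
  rw [Complex.re_ofReal_mul]
  unfold filteredNoise
  positivity

theorem norm_rankLaplace_sub_le {K r : ℕ} (hr : r ≤ 2 * K) (l : ℕ) (hc : 0 < c) (hα : 2 < α)
    (hlam : 0 < lam) (hs : 0 ≤ sigmaSq) (hP : 0 < P) (hrho : 0 ≤ rho) (hw : 0 < w.re) :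
    ‖rankLaplace K r l c α lam sigmaSq P rho u w -
        ((Real.pi * lam : ℝ) * rankDenom K r l c α P rho u w)⁻¹‖ ≤
      sigmaSq / P * (‖u‖ ^ 2 * ‖w‖ *
        ∫ x : ℝ in Set.Ioi 0, x ^ (α / 2) * Real.exp (-(Real.pi * lam * c * x))) := by
  refine (norm_laplace_sub_inv_le (by linarith) (by positivity)
    (le_re_rate hr l hc hα hlam hP hrho hw)
    (filteredNoise_div_mul_re_nonneg hs hP hw)).trans_eq ?_
  rw [norm_mul, Complex.norm_real, Real.norm_of_nonneg (by unfold filteredNoise; positivity),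
    filteredNoise]
  ring

theorem measurable_phiIntegrand : Measurable (phiIntegrand α lam sigmaSq P rho u w) := by
  unfold phiIntegrand pathLoss
  fun_prop

theorem norm_phiIntegrand_le_one (hα : 2 < α) (hlam : 0 < lam) (hs : 0 ≤ sigmaSq) (hP : 0 < P)
    (hrho : 0 ≤ rho) (hw : 0 < w.re) {x : ℝ} (hx : 0 ≤ x) :
    ‖phiIntegrand α lam sigmaSq P rho u w x‖ ≤ 1 := by
  have h1 := omegaCoeff_nonneg (u := u) hα hP hrho
  have h2 := (abs_arg_cpow_two_div hα hw).2
  rw [phiIntegrand, Complex.norm_exp, Real.exp_le_one_iff, Complex.sub_re, neg_mul,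
    Complex.neg_re, Complex.re_ofReal_mul, Complex.re_ofReal_mul]
  have h3 : 0 ≤ filteredNoise sigmaSq u / (P * pathLoss α x) * w.re := by
    unfold filteredNoise pathLoss
    positivity
  have h4 : 0 ≤ Real.pi * lam * omegaCoeff α P rho u * x ^ 2 * (w ^ ((2 / α : ℝ) : ℂ)).re := by
    positivity
  linarith

/-- Everything is expressed through `x^2`, using `x^α = (x^2)^{α/2}`, to prepare the substitution `y
= x^2`. -/
theorem phiIntegrand_of_pos {x : ℝ} (hx : 0 < x) :
    phiIntegrand α lam sigmaSq P rho u w x =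
      Complex.exp (-((Real.pi * lam * omegaCoeff α P rho u : ℝ) * w ^ ((2 / α : ℝ) : ℂ) *
          (x ^ (2 : ℝ) : ℝ)) -
        ((filteredNoise sigmaSq u / P : ℝ) : ℂ) * w * ((x ^ (2 : ℝ)) ^ (α / 2) : ℝ)) := by
  have h : filteredNoise sigmaSq u / (P * pathLoss α x) =
      filteredNoise sigmaSq u / P * (x ^ (2 : ℝ)) ^ (α / 2) := by
    rw [pathLoss, Real.rpow_neg hx.le, ← Real.rpow_mul hx.le, mul_div_cancel₀ α two_ne_zero,
      ← div_div, div_inv_eq_mul]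
  rw [phiIntegrand, h, Real.rpow_two]
  congr 1
  push_cast
  ring

/-- Binomial theorem for the power `r - 1`; the factor `2 * x ^ (2 - 1)` is left unsimplified as the
Jacobian of `y = x^2`. -/
theorem orderStatDensity_eq_sum {n r : ℕ} (hr : 1 ≤ r) (a x : ℝ) :
    orderStatDensity n r a x = r * n.choose r * ∑ l ∈ Finset.range r,
      (-1) ^ l * (r - 1).choose l *
        (a * (2 * x ^ ((2 : ℝ) - 1)) *
          Real.exp (-((n - r + l + 1 : ℕ) * a * x ^ (2 : ℝ)))) := by
  have h : (1 - Real.exp (-(a * x ^ 2))) ^ (r - 1) = ∑ l ∈ Finset.range r,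
      (-1) ^ l * (r - 1).choose l * Real.exp (-(a * x ^ 2)) ^ l := by
    rw [sub_eq_neg_add, add_pow, Nat.sub_add_cancel hr]
    refine Finset.sum_congr rfl fun l _ => ?_
    rw [neg_pow, one_pow]
    ring
  rw [orderStatDensity, sub_sub_cancel, h, Finset.sum_mul, Finset.mul_sum, Finset.sum_mul,
    Finset.mul_sum]
  refine Finset.sum_congr rfl fun l _ => ?_
  have hexp : Real.exp (-((n - r + l + 1 : ℕ) * a * x ^ (2 : ℝ))) =
      Real.exp (-(a * x ^ 2)) ^ (n - r + l + 1) := by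
    rw [← Real.exp_nat_mul, Real.rpow_two]
    ring_nf
  rw [hexp, show (2 : ℝ) - 1 = 1 by norm_num, Real.rpow_one]
  ring

theorem orderStatDensity_mul_phiIntegrand {K r : ℕ} (hr : 1 ≤ r) (hrK : r ≤ 2 * K) {x : ℝ}
    (hx : 0 < x) :
    (orderStatDensity (2 * K) r (c * lam * Real.pi) x : ℂ) *
        phiIntegrand α lam sigmaSq P rho u w x =
      ∑ l ∈ Finset.range r, (r * (2 * K).choose r : ℂ) *
        ((-1) ^ l * (r - 1).choose l * (c * (Real.pi * lam : ℝ))) *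
        ((2 * x ^ ((2 : ℝ) - 1)) • (fun y : ℝ =>
          Complex.exp (-((Real.pi * lam : ℝ) * rankDenom K r l c α P rho u w * y) -
            ((filteredNoise sigmaSq u / P : ℝ) : ℂ) * w * (y ^ (α / 2) : ℝ))) (x ^ (2 : ℝ))) := by
  rw [orderStatDensity_eq_sum hr, phiIntegrand_of_pos hx, Complex.ofReal_mul, Complex.ofReal_sum,
    Finset.mul_sum, Finset.sum_mul]
  refine Finset.sum_congr rfl fun l _ => ?_
  have hexp : Complex.exp (-((Real.pi * lam : ℝ) * rankDenom K r l c α P rho u w *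
        (x ^ (2 : ℝ) : ℝ)) -
      ((filteredNoise sigmaSq u / P : ℝ) : ℂ) * w * ((x ^ (2 : ℝ)) ^ (α / 2) : ℝ)) =
      Complex.exp ((-((2 * K - r + l + 1 : ℕ) * (c * lam * Real.pi) * x ^ (2 : ℝ)) : ℝ) : ℂ) *
      Complex.exp (-((Real.pi * lam * omegaCoeff α P rho u : ℝ) * w ^ ((2 / α : ℝ) : ℂ) *
          (x ^ (2 : ℝ) : ℝ)) -
        ((filteredNoise sigmaSq u / P : ℝ) : ℂ) * w * ((x ^ (2 : ℝ)) ^ (α / 2) : ℝ)) := by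
    rw [← Complex.exp_add, rankDenom_eq hrK]
    congr 1
    push_cast
    ring
  simp only [hexp, Complex.real_smul]
  push_cast
  ring

theorem integral_density_mul_phiIntegrand {K r : ℕ} (hr : 1 ≤ r) (hrK : r ≤ 2 * K) (hc : 0 < c)
    (hα : 2 < α) (hlam : 0 < lam) (hs : 0 ≤ sigmaSq) (hP : 0 < P) (hrho : 0 ≤ rho)
    (hw : 0 < w.re) :
    ∫ x in Set.Ioi 0, (orderStatDensity (2 * K) r (c * lam * Real.pi) x : ℂ) *
        phiIntegrand α lam sigmaSq P rho u w x =
      c * r * (2 * K).choose r * ∑ l ∈ Finset.range r, (-1) ^ l * (r - 1).choose l *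
        ((Real.pi * lam : ℝ) * rankLaplace K r l c α lam sigmaSq P rho u w) := by
  rw [setIntegral_congr_fun measurableSet_Ioi
    fun x hx => orderStatDensity_mul_phiIntegrand hr hrK hx, integral_finsetSum, Finset.mul_sum]
  · refine Finset.sum_congr rfl fun l _ => ?_
    have hsub := integral_comp_rpow_Ioi_of_pos (g := fun y : ℝ =>
      Complex.exp (-((Real.pi * lam : ℝ) * rankDenom K r l c α P rho u w * y) -
        ((filteredNoise sigmaSq u / P : ℝ) : ℂ) * w * (y ^ (α / 2) : ℝ))) (two_pos (α := ℝ))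
    rw [integral_const_mul, rankLaplace, ← hsub]
    ring
  · intro l _
    refine Integrable.const_mul ?_ _
    have h := (integrableOn_Ioi_comp_rpow_iff (fun y : ℝ =>
          Complex.exp (-((Real.pi * lam : ℝ) * rankDenom K r l c α P rho u w * y) -
            ((filteredNoise sigmaSq u / P : ℝ) : ℂ) * w * (y ^ (α / 2) : ℝ)))
          (two_ne_zero (α := ℝ))).2
      (integrableOn_exp_neg_mul_sub
        ((by positivity : 0 < Real.pi * lam * c).trans_le
          (le_re_rate hrK l hc hα hlam hP hrho hw))
        (filteredNoise_div_mul_re_nonneg hs hP hw) _)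
    rw [abs_two] at h
    exact h

end Network

section Network

variable {Ω : Type*} [MeasurableSpace Ω] {μ : Measure Ω} {N : ℕ}
  {α lam sigmaSq P rho c : ℝ} {u : EuclideanSpace ℂ (Fin N)} {w : ℂ}

theorem phi_eq_sum_rankLaplace {K r : ℕ} (hr : 1 ≤ r) (hrK : r ≤ 2 * K) (hc : 0 < c)
    (hα : 2 < α) (hlam : 0 < lam) (hs : 0 ≤ sigmaSq) (hP : 0 < P) (hrho : 0 ≤ rho)
    (hw : 0 < w.re) {X : Ω → ℝ}
    (hX : HasLaw X (volume.withDensity fun x => ENNReal.ofReal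
        (if 0 ≤ x then orderStatDensity (2 * K) r (c * lam * Real.pi) x else 0)) μ) :
    phi μ X α lam sigmaSq P rho u w =
      c * r * (2 * K).choose r * ∑ l ∈ Finset.range r, (-1) ^ l * (r - 1).choose l *
        ((Real.pi * lam : ℝ) * rankLaplace K r l c α lam sigmaSq P rho u w) := by
  rw [← integral_density_mul_phiIntegrand hr hrK hc hα hlam hs hP hrho hw,
    ← integral_withDensity_half_line (continuous_orderStatDensity _ _ _)
      (fun x hx => orderStatDensity_nonneg (by positivity) hx),
    ← hX.integral_comp measurable_phiIntegrand.aestronglyMeasurable]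
  rfl

theorem integrable_phiIntegrand_comp [IsFiniteMeasure μ] (hα : 2 < α) (hlam : 0 < lam)
    (hs : 0 ≤ sigmaSq) (hP : 0 < P) (hrho : 0 ≤ rho) (hw : 0 < w.re) {g : ℝ → ℝ} {X : Ω → ℝ}
    (hg : Measurable g)
    (hX : HasLaw X (volume.withDensity fun x => ENNReal.ofReal (if 0 ≤ x then g x else 0)) μ) :
    Integrable (fun x => phiIntegrand α lam sigmaSq P rho u w (X x)) μ := by
  have hm : Measurable fun x => if 0 ≤ x then g x else 0 :=
    Measurable.ite measurableSet_Ici hg measurable_const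
  have hnonneg : ∀ᵐ x ∂μ, 0 ≤ X x := by
    refine ae_of_ae_map hX.aemeasurable (p := fun y => 0 ≤ y) ?_
    rw [hX.map_eq, ae_withDensity_iff hm.ennreal_ofReal]
    refine .of_forall fun x hx => ?_
    by_contra h
    simp [h] at hx
  refine .of_bound (measurable_phiIntegrand.comp_aemeasurable hX.aemeasurable).aestronglyMeasurable
    1 ?_
  filter_upwards [hnonneg] with x hx
  exact norm_phiIntegrand_le_one hα hlam hs hP hrho hw hx

theorem rankDenom_ne_zero {K r : ℕ} (hr : r ≤ 2 * K) (l : ℕ) (hc : 0 < c) (hα : 2 < α) (hP : 0 < P)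
    (hrho : 0 ≤ rho) (hw : 0 < w.re) : rankDenom K r l c α P rho u w ≠ 0 := fun h => by
  have := le_re_rankDenom (u := u) hr l hc hα hP hrho hw
  rw [h, Complex.zero_re] at this
  linarith

theorem norm_phi_sub_le {K r : ℕ} (hr : 1 ≤ r) (hrK : r ≤ 2 * K) (hc : 0 < c)
    (hα : 2 < α) (hlam : 0 < lam) (hs : 0 ≤ sigmaSq) (hP : 0 < P) (hrho : 0 ≤ rho)
    (hw : 0 < w.re) {X : Ω → ℝ}
    (hX : HasLaw X (volume.withDensity fun x => ENNReal.ofReal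
        (if 0 ≤ x then orderStatDensity (2 * K) r (c * lam * Real.pi) x else 0)) μ) :
    ‖phi μ X α lam sigmaSq P rho u w -
        c * r * (2 * K).choose r * ∑ l ∈ Finset.range r, (-1) ^ l * (r - 1).choose l /
          rankDenom K r l c α P rho u w‖ ≤
      sigmaSq / P * (c * r * (2 * K).choose r * ∑ l ∈ Finset.range r, (r - 1).choose l *
        (Real.pi * lam * (‖u‖ ^ 2 * ‖w‖ *
          ∫ x : ℝ in Set.Ioi 0, x ^ (α / 2) * Real.exp (-(Real.pi * lam * c * x))))) := by
  rw [phi_eq_sum_rankLaplace hr hrK hc hα hlam hs hP hrho hw hX, ← mul_sub,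
    ← Finset.sum_sub_distrib, norm_mul]
  have hcoef : ‖(c * r * (2 * K).choose r : ℂ)‖ = c * r * (2 * K).choose r := by
    simp [abs_of_pos hc]
  rw [hcoef, mul_left_comm (sigmaSq / P), Finset.mul_sum _ _ (sigmaSq / P)]
  refine mul_le_mul_of_nonneg_left (norm_sum_le_of_le _ fun l _ => ?_) (by positivity)
  have hD := rankDenom_ne_zero (u := u) hrK l hc hα hP hrho hw
  have hpl : (0 : ℝ) < Real.pi * lam := by positivity
  have hpl' : ((Real.pi * lam : ℝ) : ℂ) ≠ 0 := by exact_mod_cast hpl.ne'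
  have heq : (-1 : ℂ) ^ l * (r - 1).choose l * ((Real.pi * lam : ℝ) *
        rankLaplace K r l c α lam sigmaSq P rho u w) -
      (-1) ^ l * (r - 1).choose l / rankDenom K r l c α P rho u w =
      (-1) ^ l * (r - 1).choose l * (Real.pi * lam : ℝ) *
        (rankLaplace K r l c α lam sigmaSq P rho u w -
          ((Real.pi * lam : ℝ) * rankDenom K r l c α P rho u w)⁻¹) := by
    field_simp
  rw [heq, norm_mul]
  refine (mul_le_mul_of_nonneg_left
    (norm_rankLaplace_sub_le hrK l hc hα hlam hs hP hrho hw) (norm_nonneg _)).trans_eq ?_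
  rw [norm_mul, norm_mul, norm_pow, norm_neg, norm_one, one_pow, one_mul, Complex.norm_natCast,
    Complex.norm_real, Real.norm_of_nonneg hpl.le]
  ring

end Network

theorem theorem4
    {Ω : Type*} [MeasurableSpace Ω] (μ : Measure Ω) [IsProbabilityMeasure μ]
    (K N : ℕ)
    -- `r` is the rank of the near user, `r'` the rank of the far user of the pair
    (r r' : ℕ) (hr : 1 ≤ r) (hrr' : r < r') (hr' : r' ≤ 2 * K)
    (c α lam : ℝ) (hc : 0 < c) (hα : 2 < α) (hlam : 0 < lam)
    -- the distances of the `2 K` users to their base station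
    (d : Fin (2 * K) → Ω → ℝ) (hindep : iIndepFun d μ)
    (hlaw : ∀ i, HasLaw (d i) (distLaw c lam) μ)
    -- the receive filter of the near user
    (u : EuclideanSpace ℂ (Fin N)) (hu : u ≠ 0)
    (s t : ℂ) (hs : 0 < s.re) (ht : 0 < t.re) :
    -- the expectation that defines `φ` exists
    (∀ sigmaSq P rho : ℝ, 0 ≤ sigmaSq → 0 < P → 0 ≤ rho →
      Integrable (fun x => phiIntegrand α lam sigmaSq P rho u (s + t)
        (orderStat (fun i => d i x) r)) μ) ∧
    -- the exact expression
    (∀ sigmaSq P rho : ℝ, 0 < sigmaSq → 0 < P → 0 ≤ rho →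
      (∀ l ∈ Finset.range r, FoxHWellDefined 1 1 ![0] ![α / 2] ![0] ![1]
        (foxArg K r l c α lam sigmaSq P rho u (s + t))) ∧
      phi μ (fun x => orderStat (fun i => d i x) r) α lam sigmaSq P rho u (s + t) =
        (c : ℂ) * r * (Nat.choose (2 * K) r) *
          ∑ l ∈ Finset.range r,
            (-1 : ℂ) ^ l * (Nat.choose (r - 1) l) *
              foxH 1 1 ![0] ![α / 2] ![0] ![1]
                (foxArg K r l c α lam sigmaSq P rho u (s + t)) /
              rankDenom K r l c α P rho u (s + t)) ∧
    -- the interference-limited regime `σ² / P → 0`, uniformly in `P` and `ρ_I`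
    (∀ ε : ℝ, 0 < ε → ∃ δ : ℝ, 0 < δ ∧
      ∀ sigmaSq P rho : ℝ, 0 ≤ sigmaSq → 0 < P → 0 ≤ rho → sigmaSq / P < δ →
        ‖phi μ (fun x => orderStat (fun i => d i x) r) α lam sigmaSq P rho u (s + t) -
          (c : ℂ) * r * (Nat.choose (2 * K) r) *
            ∑ l ∈ Finset.range r,
              (-1 : ℂ) ^ l * (Nat.choose (r - 1) l) /
                rankDenom K r l c α P rho u (s + t)‖ < ε) := by
  have hrK : r ≤ 2 * K := by omega
  have hw : 0 < (s + t).re := by rw [Complex.add_re]; linarith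
  have hX := hasLaw_orderStat hr hrK hc hlam hindep hlaw
  refine ⟨fun sigmaSq P rho hσ hP hrho => ?_, fun sigmaSq P rho hσ hP hrho => ⟨fun l _ => ?_, ?_⟩,
    fun ε hε => ?_⟩
  · exact integrable_phiIntegrand_comp hα hlam hσ hP hrho hw
      (continuous_orderStatDensity _ _ _).measurable hX
  · exact (foxH_foxArg hrK l hc hα hlam hσ hP hrho hu hw).1
  · rw [phi_eq_sum_rankLaplace hr hrK hc hα hlam hσ.le hP hrho hw hX]
    congr 1
    refine Finset.sum_congr rfl fun l _ => ?_
    -- The Fox value carries a factor `π λ D_l`, whose `D_l` cancels the denominator.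
    rw [(foxH_foxArg hrK l hc hα hlam hσ hP hrho hu hw).2]
    have := rankDenom_ne_zero (u := u) hrK l hc hα hP hrho hw
    field_simp
  · have hI : 0 ≤ ∫ x : ℝ in Set.Ioi 0, x ^ (α / 2) * Real.exp (-(Real.pi * lam * c * x)) :=
      setIntegral_nonneg measurableSet_Ioi fun x (hx : 0 < x) => by positivity
    obtain ⟨M, hM, hM0⟩ : ∃ M : ℝ, M = c * r * (2 * K).choose r * ∑ l ∈ Finset.range r,
        (r - 1).choose l * (Real.pi * lam * (‖u‖ ^ 2 * ‖s + t‖ *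
          ∫ x : ℝ in Set.Ioi 0, x ^ (α / 2) * Real.exp (-(Real.pi * lam * c * x)))) ∧ 0 ≤ M :=
      ⟨_, rfl, by positivity⟩
    -- M may be 0, hence `M + 1`; M depends on neither P nor `rho`.
    refine ⟨ε / (M + 1), by positivity, fun sigmaSq P rho hσ hP hrho hδ => ?_⟩
    refine (norm_phi_sub_le hr hrK hc hα hlam hσ hP hrho hw hX).trans_lt ?_
    rw [← hM]
    rw [lt_div_iff₀ (by positivity)] at hδ
    have : 0 ≤ sigmaSq / P := by positivity
    linarith
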